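/- **Setting.** Let $(\mathfrak X,\mathscr X)$ be a measurable space with a $\sigma$-finite measure $\mu$, and let $f_0,f_1$ be two probability densities with respect to $\mu$ with $\mu\{f_0\ne f_1\}>0$. Observations arrive in groups numbered $k=1,2,\dots$; the size of group $k$ takes values in $\mathscr G\subset\{0,1,2,\dots\}$ with probability mass function $p_k$, the sizes are independent, and, given the sizes, all observations are i.i.d. with density $f_i$ under $H_i$. For $n=(n_1,\dots,n_k)\in\mathscr G^k$ put $p(n)=\prod_{i\le k}p_i(n_i)$, let $\mathfrak X^n=\mathfrak X^{n_1}\times\dots\times\mathfrak X^{n_k}$, let $f_i^{(n)}$ be the product density on $\mathfrak X^n$, let $P_i$, $E_i$ denote probability and expectation under this density, and let $z_n=f_1^{(n)}/f_0^{(n)}$ (with $a/0=\infty$ for $a>0$ and $0/0=0$). A group of $m$ observations costs $c(m)\ge 0$; $c(n)=\sum_{i\le k}c(n_i)$, and $\bar c_k=\sum_{m\in\mathscr G}p_k(m)c(m)$ is assumed to satisfy $0<\bar c_k<\infty$ for all $k\ge1$. Fix $\lambda_0,\lambda_1>0$ and let $g(z)=\min\{\lambda_0,\lambda_1z\}$.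 A stopping rule $\psi$ (a decision rule $\phi$) is a family of measurable functions $\psi_n$ ($\phi_n$) $:\mathfrak X^n\to[0,1]$, $n\in\mathscr G^k$, $k\ge1$. For $n\in\mathscr G^k$ let $t_n^\psi=\prod_{j=1}^{k-1}(1-\psi_{(n_1,\dots,n_j)})$, $s_n^\psi=t_n^\psi\psi_n$ and $T_n^\psi=\{t_n^\psi>0\}$. Let $\mathscr F_0$ be the set of stopping rules with $\sum_{k\ge1}\sum_{n\in\mathscr G^k}p(n)E_0s_n^\psi=1$. Let $$L(\psi)=\inf_\phi\Big[\sum_{k\ge1}\sum_{n\in\mathscr G^k}p(n)\big(c(n)E_0s^\psi_n+\lambda_0E_0s_n^\psi\phi_n+\lambda_1E_1s_n^\psi(1-\phi_n)\big)\Big]\in[0,\infty].$$ For $N\ge1$ define $V_N^N=g$ and, for $k=N,N-1,\dots,2$, $V_{k-1}^N(z)=\min\{g(z),\bar c_k+\bar V_k^N(z)\}$, where $\bar V_k^N(z)=\sum_{m\in\mathscr G}p_k(m)E_0V_k^N(zz_m)$ for $1\le k\le N$. **Theorem.** For all $k\ge1$ and $0\le z<\infty$ the limit $V_k(z)=\lim_{N\to\infty}V_k^N(z)$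 exists, and $\lim_{N\to\infty}\bar V_k^N(z)=\bar V_k(z):=\sum_{m\in\mathscr G}p_k(m)E_0V_k(zz_m)$. For every stopping rule $\psi\in\mathscr F_0$, $$L(\psi)=\sum_{k\ge1}\sum_{n\in\mathscr G^k}p(n)E_0s_n^\psi\big(c(n)+g(z_n)\big)\qquad\text{and}\qquad L(\psi)\ge\bar c_1+\bar V_1(1).$$ Equality $L(\psi)=\bar c_1+\bar V_1(1)$ holds if and only if $\psi$ satisfies Condition $\mathfrak S_\infty(\psi)$: for all $k\ge1$ and all $n\in\mathscr G^k$ with $p(n)>0$, $P_0$-almost surely on $T_n^\psi$, $$I_{\{g(z_n)<\bar c_{k+1}+\bar V_{k+1}(z_n)\}}\le\psi_n\le I_{\{g(z_n)\le\bar c_{k+1}+\bar V_{k+1}(z_n)\}}.$$ -/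

import Mathlib

open MeasureTheory Filter Topology
open scoped ENNReal NNReal

noncomputable section

/-- The random group-size model for testing `H₀ : f 0` against `H₁ : f 1`. Groups are numbered
`1, 2, …`; index `0` of `p` is not used anywhere. -/
structure GroupSeqModel (X : Type*) [MeasurableSpace X] where
  /-- the dominating measure -/
  mu : Measure X
  sigmaFinite : SigmaFinite mu
  /-- the densities of one observation under `H₀` and under `H₁` -/
  f : Fin 2 → X → ℝ≥0
  measurable_f : ∀ i, Measurable (f i)
  lintegral_f : ∀ i, ∫⁻ x, (f i x : ℝ≥0∞) ∂mu = 1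
  /-- the two hypothetical distributions are distinct -/
  distinct : 0 < mu {x | f 0 x ≠ f 1 x}
  /-- the set of possible group sizes -/
  G : Set ℕ
  /-- `p k` is the probability mass function of the size of the `k`-th group -/
  p : ℕ → PMF G
  /-- the cost of a group of a given size -/
  cost : G → ℝ≥0
  /-- the average cost of the `k`-th group is positive … -/
  avgCost_pos : ∀ k, 1 ≤ k → 0 < ∑' m : G, p k m * cost m
  /-- … and finite -/
  avgCost_lt_top : ∀ k, 1 ≤ k → ∑' m : G, p k m * cost m < ∞

namespace GroupSeqModel

variable {X : Type*} [MeasurableSpace X] (M : GroupSeqModel X)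

/-- The space `X^n` of data `(x₁, …, x_k)`, `x_i ∈ X^{n_i}`, for group sizes `n = (n₁, …, n_k)`. -/
abbrev Data {k : ℕ} (n : Fin k → M.G) : Type _ := ∀ i : Fin k, Fin (n i : ℕ) → X

/-- The product measure `μ^n` on `X^n`. -/
def muProd {k : ℕ} (n : Fin k → M.G) : Measure (M.Data n) :=
  haveI := M.sigmaFinite
  Measure.pi fun _ => Measure.pi fun _ => M.mu

/-- The joint density of the data under `H_i`, given the group sizes. -/
def density (i : Fin 2) {k : ℕ} (n : Fin k → M.G) (x : M.Data n) : ℝ≥0∞ :=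
  ∏ l : Fin k, ∏ j : Fin (n l : ℕ), (M.f i (x l j) : ℝ≥0∞)

/-- The law of the data under `H_i`, given the group sizes. -/
def P (i : Fin 2) {k : ℕ} (n : Fin k → M.G) : Measure (M.Data n) :=
  (M.muProd n).withDensity (M.density i n)

/-- The probability `p(n) = p₁(n₁) ⋯ p_k(n_k)` of the group sizes `n`. -/
def prob {k : ℕ} (n : Fin k → M.G) : ℝ≥0∞ :=
  ∏ l : Fin k, M.p (l + 1) (n l)

/-- The total cost `c(n) = c(n₁) + ⋯ + c(n_k)`. -/
def totalCost {k : ℕ} (n : Fin k → M.G) : ℝ≥0∞ :=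
  ∑ l : Fin k, (M.cost (n l) : ℝ≥0∞)

/-- The average cost of the `k`-th group. -/
def avgCost (k : ℕ) : ℝ≥0∞ :=
  ∑' m : M.G, M.p k m * M.cost m

/-- The likelihood ratio `z_n`. In `[0, ∞]` one has `a / 0 = ∞` for `a > 0` and `0 / 0 = 0`. -/
def z {k : ℕ} (n : Fin k → M.G) (x : M.Data n) : ℝ≥0∞ :=
  M.density 1 n x / M.density 0 n x

/-- A family of measurable functions `X^n → [0, 1]`, one for each vector `n` of group sizes.
Only the components with `k ≥ 1` are ever used. -/
structure Rule where
  val : ∀ {k : ℕ} (n : Fin k → M.G), M.Data n → ℝ≥0∞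
  measurable_val : ∀ {k : ℕ} (n : Fin k → M.G), Measurable (val n)
  val_le_one : ∀ {k : ℕ} (n : Fin k → M.G) (x : M.Data n), val n x ≤ 1

/-- Randomized stopping rules: `val n x` is the conditional probability to stop. -/
abbrev StoppingRule := M.Rule

/-- Randomized decision rules: `val n x` is the conditional probability to reject `H₀`. -/
abbrev DecisionRule := M.Rule

variable {M}

/-- `t_n = (1 - ψ_{(n₁)}) ⋯ (1 - ψ_{(n₁, …, n_{k-1})})`, each factor evaluated at the corresponding
initial segment of the data. -/
def Rule.t (ψ : M.StoppingRule) {k : ℕ} (n : Fin k → M.G) (x : M.Data n) : ℝ≥0∞ :=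
  ∏ j : Fin (k - 1),
    (1 - ψ.val (k := j + 1) (fun i => n (Fin.castLE (by omega) i))
      (fun i => x (Fin.castLE (by omega) i)))

/-- `s_n = t_n ψ_n`. -/
def Rule.s (ψ : M.StoppingRule) {k : ℕ} (n : Fin k → M.G) (x : M.Data n) : ℝ≥0∞ :=
  ψ.t n x * ψ.val n x

variable (M)

/-- The class `F_i` of the stopping rules that terminate with probability one under `H_i`. -/
def terminating (i : Fin 2) : Set M.StoppingRule :=
  {ψ | ∑' k : ℕ, ∑' n : Fin (k + 1) → M.G, M.prob n * ∫⁻ x, ψ.s n x ∂M.P i n = 1}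

/-- The average total cost under `H_i`. -/
def K (i : Fin 2) (ψ : M.StoppingRule) : ℝ≥0∞ :=
  ∑' k : ℕ, ∑' n : Fin (k + 1) → M.G, M.prob n * M.totalCost n * ∫⁻ x, ψ.s n x ∂M.P i n

/-- The type I error probability. -/
def errorI (ψ : M.StoppingRule) (φ : M.DecisionRule) : ℝ≥0∞ :=
  ∑' k : ℕ, ∑' n : Fin (k + 1) → M.G, M.prob n * ∫⁻ x, ψ.s n x * φ.val n x ∂M.P 0 n

/-- The type II error probability. -/
def errorII (ψ : M.StoppingRule) (φ : M.DecisionRule) : ℝ≥0∞ :=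
  ∑' k : ℕ, ∑' n : Fin (k + 1) → M.G, M.prob n * ∫⁻ x, ψ.s n x * (1 - φ.val n x) ∂M.P 1 n

/-- The Lagrangian function of a test `(ψ, φ)`. -/
def lagrangian (l0 l1 : ℝ≥0) (ψ : M.StoppingRule) (φ : M.DecisionRule) : ℝ≥0∞ :=
  M.K 0 ψ + l0 * M.errorI ψ φ + l1 * M.errorII ψ φ

/-- `L(ψ) = inf_φ L(ψ, φ)`. -/
def L (l0 l1 : ℝ≥0) (ψ : M.StoppingRule) : ℝ≥0∞ :=
  ⨅ φ : M.DecisionRule, M.lagrangian l0 l1 ψ φ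

/-- `g(z) = min {λ₀, λ₁ z}`. -/
def g (l0 l1 : ℝ≥0) (z : ℝ≥0∞) : ℝ≥0∞ := min (l0 : ℝ≥0∞) (l1 * z)

/-- The averaging `z ↦ ∑_m p_k(m) E₀ F(z z_m)` over the `k`-th group alone. -/
def groupMean (k : ℕ) (F : ℝ≥0∞ → ℝ≥0∞) (z : ℝ≥0∞) : ℝ≥0∞ :=
  ∑' m : M.G, M.p k m *
    ∫⁻ x, F (z * M.z (fun _ : Fin 1 => m) x) ∂M.P 0 (fun _ : Fin 1 => m)

/-- Backward induction by the number of steps left: `VSteps d k` is `V_k^{k+d}`. -/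
def VSteps (l0 l1 : ℝ≥0) : ℕ → ℕ → ℝ≥0∞ → ℝ≥0∞
  | 0, _, z => g l0 l1 z
  | d + 1, k, z =>
      min (g l0 l1 z) (M.avgCost (k + 1) + M.groupMean (k + 1) (VSteps l0 l1 d (k + 1)) z)

/-- The function `V_k^N`, for `1 ≤ k ≤ N`. -/
def VN (l0 l1 : ℝ≥0) (N k : ℕ) (z : ℝ≥0∞) : ℝ≥0∞ := M.VSteps l0 l1 (N - k) k z

/-- The function `V̄_k^N`, for `1 ≤ k ≤ N`. -/
def VNbar (l0 l1 : ℝ≥0) (N k : ℕ) (z : ℝ≥0∞) : ℝ≥0∞ := M.groupMean k (M.VN l0 l1 N k) z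

/-- `V_k = lim_N V_k^N`. -/
def V (l0 l1 : ℝ≥0) (k : ℕ) (z : ℝ≥0∞) : ℝ≥0∞ := limUnder atTop fun N => M.VN l0 l1 N k z

/-- `V̄_k(z) = ∑_m p_k(m) E₀ V_k(z z_m)`. -/
def Vbar (l0 l1 : ℝ≥0) (k : ℕ) (z : ℝ≥0∞) : ℝ≥0∞ := M.groupMean k (M.V l0 l1 k) z

/-- `r ≃ I_{a ≼ b}`, that is, `I_{a < b} ≤ r ≤ I_{a ≤ b}`. -/
def SimInd (r a b : ℝ≥0∞) : Prop :=
  (if a < b then 1 else 0) ≤ r ∧ r ≤ (if a ≤ b then 1 else 0)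

/-- Condition `S_∞(ψ)`. -/
def CondS (l0 l1 : ℝ≥0) (ψ : M.StoppingRule) : Prop :=
  ∀ k : ℕ, 1 ≤ k → ∀ n : Fin k → M.G, 0 < M.prob n →
    ∀ᵐ x ∂M.P 0 n, 0 < ψ.t n x →
      SimInd (ψ.val n x) (g l0 l1 (M.z n x))
        (M.avgCost (k + 1) + M.Vbar l0 l1 (k + 1) (M.z n x))

end GroupSeqModel

end

/-! The optimal decision rule is found pointwise: for nonnegative `a`, `b`, the weighted sum `a φ +
b (1 - φ)` is at least `min a b`, and the likelihood ratio test attains the minimum. This gives the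
formula for `L` (`L_eq_tsum`).

For the stopping problem, `V_k^N` decreases in `N` and is bounded by `λ₀`, so dominated convergence
yields the limits and the optimality equation `V_k = min (g, c̄_{k+1} + V̄_{k+1})` (`V_eq`). At each
stage the optimal continuation value plus the `loss` of the rule equals the payoff from stopping
plus the continuation value one group later (`mean_value_step`). Telescoping gives `value_add_loss`:
the lower bound plus the losses of `N` stages equals the cost of stopping in these stages plus a
remainder.

If the rule terminates and `L` is finite, the remainder vanishes: the surviving mass tends to `0`,
and the cost carried by it is at most a tail of the convergent series of stopping costs
(`mean_t_cost_le`). Hence `L` is the lower bound plus the total loss, and the loss is zero exactly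
under `CondS`. All of this is done in `[0, ∞]`, with identities written additively. -/

noncomputable section

/-! ### Product measures. -/

/-- Tonelli's theorem for a product of functions of one coordinate each. -/
theorem MeasureTheory.lintegral_pi_prod_eq_prod {n : ℕ} {E : Fin n → Type*}
    [∀ i, MeasurableSpace (E i)] (μ : ∀ i, Measure (E i)) [∀ i, SigmaFinite (μ i)]
    (f : ∀ i, E i → ℝ≥0∞) (hf : ∀ i, Measurable (f i)) :
    ∫⁻ x, ∏ i, f i (x i) ∂Measure.pi μ = ∏ i, ∫⁻ x, f i x ∂μ i := by
  induction n with
  | zero => simp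
  | succ n ih =>
    have h := (measurePreserving_piFinSuccAbove μ 0).symm
    rw [← h.lintegral_comp_emb (MeasurableEquiv.measurableEmbedding _)]
    simp_rw [MeasurableEquiv.piFinSuccAbove_symm_apply, Fin.insertNthEquiv,
      Fin.prod_univ_succ, Equiv.coe_fn_mk, Fin.insertNth_zero]
    change ∫⁻ a : E 0 × (∀ j : Fin n, E j.succ), f 0 a.1 * ∏ j, f j.succ (a.2 j)
      ∂((μ 0).prod (Measure.pi fun j : Fin n => μ j.succ)) = _
    have hp : Measurable fun y : ∀ j : Fin n, E j.succ => ∏ j, f j.succ (y j) :=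
      Finset.measurable_prod _ fun j _ => (hf _).comp (measurable_pi_apply j)
    rw [lintegral_prod_mul (hf 0).aemeasurable hp.aemeasurable]
    congr 1
    exact ih (fun i => μ i.succ) (fun i => f i.succ) fun i => hf _

/-- A product of `σ`-finite measures over `Fin (k + 1)` is the image of the product of the first `k`
factors and of the last one, the latter presented as a product over `Fin 1`. -/
theorem MeasureTheory.Measure.pi_eq_map_snoc {k : ℕ} {E : Fin (k + 1) → Type*}
    [∀ i, MeasurableSpace (E i)] (μ : ∀ i, Measure (E i)) [∀ i, SigmaFinite (μ i)] :
    Measurable (fun q : (∀ i : Fin k, E i.castSucc) × (Fin 1 → E (Fin.last k)) =>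
      (Fin.snoc (α := E) q.1 (q.2 0) : ∀ i, E i)) ∧
    Measure.pi μ = Measure.map
      (fun q : (∀ i : Fin k, E i.castSucc) × (Fin 1 → E (Fin.last k)) =>
        (Fin.snoc (α := E) q.1 (q.2 0) : ∀ i, E i))
      ((Measure.pi fun i : Fin k => μ i.castSucc).prod
        (Measure.pi fun _ : Fin 1 => μ (Fin.last k))) := by
  have hm : Measurable (fun q : (∀ i : Fin k, E i.castSucc) × (Fin 1 → E (Fin.last k)) =>
      (Fin.snoc (α := E) q.1 (q.2 0) : ∀ i, E i)) := by
    refine measurable_pi_lambda _ fun i => ?_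
    induction i using Fin.lastCases with
    | last => simp only [Fin.snoc_last]; fun_prop
    | cast i => simp only [Fin.snoc_castSucc]; fun_prop
  refine ⟨hm, Measure.pi_eq fun s hs => ?_⟩
  rw [Measure.map_apply hm (MeasurableSet.univ_pi hs)]
  have : (fun q : (∀ i : Fin k, E i.castSucc) × (Fin 1 → E (Fin.last k)) =>
      (Fin.snoc (α := E) q.1 (q.2 0) : ∀ i, E i)) ⁻¹' Set.univ.pi s =
      (Set.univ.pi fun i : Fin k => s i.castSucc) ×ˢ
        (Set.univ.pi fun _ : Fin 1 => s (Fin.last k)) := by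
    ext q
    simp only [Set.mem_preimage, Set.mem_univ_pi, Set.mem_prod, Fin.forall_fin_succ',
      Fin.snoc_castSucc, Fin.snoc_last]
    simp
  rw [this, Measure.prod_prod, Measure.pi_pi, Measure.pi_pi,
    Fin.prod_univ_castSucc fun i => μ i (s i)]
  simp

/-! ### The law of the data and conditioning on all groups but the last. -/

namespace GroupSeqModel

variable {X : Type*} [MeasurableSpace X] (M : GroupSeqModel X)

theorem measurable_density (i : Fin 2) {k : ℕ} (n : Fin k → M.G) :
    Measurable (M.density i n) := by
  have h := M.measurable_f i
  unfold density
  fun_prop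

theorem measurable_z {k : ℕ} (n : Fin k → M.G) : Measurable (M.z n) :=
  (M.measurable_density 1 n).div (M.measurable_density 0 n)

theorem density_ne_top (i : Fin 2) {k : ℕ} (n : Fin k → M.G) (x : M.Data n) :
    M.density i n x ≠ ∞ :=
  ENNReal.prod_ne_top fun _ _ => ENNReal.prod_ne_top fun _ _ => ENNReal.coe_ne_top

instance {k : ℕ} (n : Fin k → M.G) : SigmaFinite (M.muProd n) := by
  have := M.sigmaFinite
  unfold muProd
  infer_instance

theorem lintegral_P (i : Fin 2) {k : ℕ} (n : Fin k → M.G) {h : M.Data n → ℝ≥0∞}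
    (hh : Measurable h) :
    ∫⁻ x, h x ∂M.P i n = ∫⁻ x, M.density i n x * h x ∂M.muProd n :=
  lintegral_withDensity_eq_lintegral_mul _ (M.measurable_density i n) hh

instance (i : Fin 2) {k : ℕ} (n : Fin k → M.G) : IsProbabilityMeasure (M.P i n) := by
  constructor
  have := M.sigmaFinite
  have hf := M.measurable_f i
  rw [P, withDensity_apply _ MeasurableSet.univ, Measure.restrict_univ]
  unfold density muProd
  rw [lintegral_pi_prod_eq_prod _
    (fun l (y : Fin (n l : ℕ) → X) => ∏ j, (M.f i (y j) : ℝ≥0∞)) fun l => by fun_prop]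
  refine Finset.prod_eq_one fun l _ => ?_
  rw [lintegral_pi_prod_eq_prod _ (fun _ (y : X) => (M.f i y : ℝ≥0∞)) fun _ => by fun_prop]
  simp [M.lintegral_f i]

/-- Integration over `k + 1` groups as an iterated integral: first the last group, then the rest. -/
theorem lintegral_P_succ (i : Fin 2) {k : ℕ} (n : Fin (k + 1) → M.G)
    (H : M.Data (fun l : Fin k => n l.castSucc) → M.Data (fun _ : Fin 1 => n (Fin.last k)) → ℝ≥0∞)
    (hH : Measurable (Function.uncurry H)) :
    ∫⁻ x, H (fun l => x l.castSucc) (fun _ => x (Fin.last k)) ∂M.P i n =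
      ∫⁻ x, ∫⁻ y, H x y ∂M.P i (fun _ : Fin 1 => n (Fin.last k))
        ∂M.P i (fun l : Fin k => n l.castSucc) := by
  have := M.sigmaFinite
  have hd := M.measurable_density i (fun l : Fin k => n l.castSucc)
  have hd1 := M.measurable_density i (fun _ : Fin 1 => n (Fin.last k))
  have hdn := M.measurable_density i n
  obtain ⟨hm, hmap⟩ := Measure.pi_eq_map_snoc
    (fun l => Measure.pi fun _ : Fin (n l : ℕ) => M.mu)
  have hH1 : Measurable fun x : M.Data n => H (fun l => x l.castSucc) (fun _ => x (Fin.last k)) :=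
    hH.comp (f := fun x : M.Data n => ((fun l => x l.castSucc : M.Data (fun l : Fin k => n l.castSucc)),
      (fun _ => x (Fin.last k) : M.Data (fun _ : Fin 1 => n (Fin.last k))))) (by fun_prop)
  have hH2 : Measurable fun x => ∫⁻ y, H x y ∂M.P i (fun _ : Fin 1 => n (Fin.last k)) :=
    hH.lintegral_prod_right'
  rw [M.lintegral_P i n hH1, M.lintegral_P i _ hH2]
  have hmu : M.muProd n = Measure.map _ _ := hmap
  have hprod : Measurable fun x : M.Data n => M.density i n x *
      H (fun l => x l.castSucc) (fun _ => x (Fin.last k)) := hdn.mul hH1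
  rw [hmu, lintegral_map hprod hm]
  refine (lintegral_prod (μ := M.muProd fun l : Fin k => n l.castSucc)
    (ν := M.muProd fun _ : Fin 1 => n (Fin.last k)) _ (hprod.comp hm).aemeasurable).trans ?_
  refine lintegral_congr fun x => ?_
  have hHx : Measurable (H x) := hH.comp measurable_prodMk_left
  rw [M.lintegral_P i _ hHx, ← lintegral_const_mul' _ _ (M.density_ne_top _ _ _)]
  refine lintegral_congr fun y => ?_
  -- The gluing map only sees `y 0`, so the `Fin 1`-indexed argument of `H` has to be recovered from
  -- it.
  have h0 : (fun _ : Fin 1 => y 0) = y := by ext l; fin_cases l; rfl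
  simp only [density, Function.comp_apply, Fin.prod_univ_castSucc, mul_assoc]
  simp only [Fin.snoc_castSucc, Fin.snoc_last, Finset.univ_eq_empty, Finset.prod_empty, one_mul]
  exact congrArg (fun w => _ * (_ * H x w)) h0

/-- Finiteness of the densities makes this compatible with the conventions for division by zero: `∞
* 0 = 0` agrees with `0 / 0 = 0`. -/
theorem z_succ {k : ℕ} (n : Fin (k + 1) → M.G) (x : M.Data n) :
    M.z n x = M.z (fun l : Fin k => n l.castSucc) (fun l => x l.castSucc) *
      M.z (fun _ : Fin 1 => n (Fin.last k)) (fun _ => x (Fin.last k)) := by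
  have h : ∀ i, M.density i n x = M.density i (fun l : Fin k => n l.castSucc) (fun l => x l.castSucc) *
      M.density i (fun _ : Fin 1 => n (Fin.last k)) (fun _ => x (Fin.last k)) := fun i => by
    simp [density, Fin.prod_univ_castSucc]
  simp only [z, h]
  exact ENNReal.mul_div_mul_comm (.inr (M.density_ne_top _ _ _)) (.inl (M.density_ne_top _ _ _))

theorem totalCost_succ {k : ℕ} (n : Fin (k + 1) → M.G) :
    M.totalCost n = M.totalCost (fun l : Fin k => n l.castSucc) + M.cost (n (Fin.last k)) :=
  Fin.sum_univ_castSucc _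

theorem prob_succ {k : ℕ} (n : Fin (k + 1) → M.G) :
    M.prob n = M.prob (fun l : Fin k => n l.castSucc) * M.p (k + 1) (n (Fin.last k)) :=
  Fin.prod_univ_castSucc _

theorem t_succ (ψ : M.StoppingRule) {k : ℕ} (n : Fin (k + 1 + 1) → M.G) (x : M.Data n) :
    ψ.t n x = ψ.t (fun l : Fin (k + 1) => n l.castSucc) (fun l => x l.castSucc) *
      (1 - ψ.val (fun l : Fin (k + 1) => n l.castSucc) (fun l => x l.castSucc)) :=
  Fin.prod_univ_castSucc _

theorem t_one (ψ : M.StoppingRule) (n : Fin 1 → M.G) (x : M.Data n) : ψ.t n x = 1 := rfl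

theorem measurable_t (ψ : M.StoppingRule) {k : ℕ} (n : Fin k → M.G) : Measurable (ψ.t n) := by
  refine Finset.measurable_prod _ fun j _ => measurable_const.sub ?_
  exact (ψ.measurable_val _).comp (by fun_prop)

theorem measurable_s (ψ : M.StoppingRule) {k : ℕ} (n : Fin k → M.G) : Measurable (ψ.s n) :=
  (M.measurable_t ψ n).mul (ψ.measurable_val n)

/-- The expectation under `H₀`, over the sizes of the first `k` groups and over the data. -/
def mean (k : ℕ) (h : ∀ n : Fin k → M.G, M.Data n → ℝ≥0∞) : ℝ≥0∞ :=
  ∑' n : Fin k → M.G, M.prob n * ∫⁻ x, h n x ∂M.P 0 n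

variable {M}

theorem mean_congr {k : ℕ} {h h' : ∀ n : Fin k → M.G, M.Data n → ℝ≥0∞}
    (hh : ∀ n x, h n x = h' n x) : M.mean k h = M.mean k h' := by
  simp only [mean, hh]

theorem mean_mono {k : ℕ} {h h' : ∀ n : Fin k → M.G, M.Data n → ℝ≥0∞}
    (hh : ∀ n x, h n x ≤ h' n x) : M.mean k h ≤ M.mean k h' :=
  ENNReal.tsum_le_tsum fun n => mul_le_mul_right (lintegral_mono (hh n)) _

theorem mean_add {k : ℕ} {h h' : ∀ n : Fin k → M.G, M.Data n → ℝ≥0∞}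
    (hh : ∀ n, Measurable (h n)) :
    M.mean k (fun n x => h n x + h' n x) = M.mean k h + M.mean k h' := by
  simp only [mean, lintegral_add_left (hh _), mul_add, ENNReal.tsum_add]

theorem mean_const_mul {k : ℕ} {h : ∀ n : Fin k → M.G, M.Data n → ℝ≥0∞}
    (hh : ∀ n, Measurable (h n)) (a : ℝ≥0∞) :
    M.mean k (fun n x => a * h n x) = a * M.mean k h := by
  simp only [mean, lintegral_const_mul _ (hh _), ← ENNReal.tsum_mul_left]
  exact tsum_congr fun n => by ring

theorem mean_one (h : ∀ n : Fin 1 → M.G, M.Data n → ℝ≥0∞) :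
    M.mean 1 h = ∑' m : M.G, M.p 1 m *
      ∫⁻ x, h (fun _ => m) x ∂M.P 0 (fun _ : Fin 1 => m) := by
  rw [mean, ← (Equiv.funUnique (Fin 1) M.G).symm.tsum_eq]
  refine tsum_congr fun m => ?_
  change M.prob (fun _ : Fin 1 => m) * ∫⁻ x, h (fun _ => m) x ∂M.P 0 (fun _ : Fin 1 => m) = _
  simp [prob]

/-- One-step conditioning: the expectation over `k + 1` groups is computed by averaging first over
the last group. -/
theorem mean_succ {k : ℕ}
    (H : ∀ (n : Fin k → M.G) (m : M.G), M.Data n → M.Data (fun _ : Fin 1 => m) → ℝ≥0∞)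
    (hH : ∀ n m, Measurable (Function.uncurry (H n m))) :
    M.mean (k + 1) (fun n x => H (fun l => n l.castSucc) (n (Fin.last k))
        (fun l => x l.castSucc) (fun _ => x (Fin.last k))) =
      M.mean k (fun n x => ∑' m : M.G, M.p (k + 1) m *
        ∫⁻ y, H n m x y ∂M.P 0 (fun _ : Fin 1 => m)) := by
  have hm : ∀ n m, Measurable fun x => ∫⁻ y, H n m x y ∂M.P 0 (fun _ : Fin 1 => m) :=
    fun n m => (hH n m).lintegral_prod_right'
  simp only [mean]
  calc _ = ∑' n : Fin (k + 1) → M.G, (fun q : (Fin k → M.G) × M.G =>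
        M.prob q.1 * (M.p (k + 1) q.2 * ∫⁻ x, ∫⁻ y, H q.1 q.2 x y ∂M.P 0 (fun _ : Fin 1 => q.2)
          ∂M.P 0 q.1)) ((fun l => n l.castSucc), n (Fin.last k)) := by
        refine tsum_congr fun n => ?_
        rw [M.prob_succ, M.lintegral_P_succ 0 n _ (hH _ _), mul_assoc]
    _ = ∑' q : (Fin k → M.G) × M.G,
        M.prob q.1 * (M.p (k + 1) q.2 * ∫⁻ x, ∫⁻ y, H q.1 q.2 x y ∂M.P 0 (fun _ : Fin 1 => q.2)
          ∂M.P 0 q.1) := by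
        rw [← ((Fin.snocEquiv fun _ => M.G).symm.trans (Equiv.prodComm _ _)).tsum_eq]
        rfl
    _ = _ := by
        rw [ENNReal.tsum_prod']
        refine tsum_congr fun n => ?_
        dsimp only
        rw [ENNReal.tsum_mul_left, lintegral_tsum fun m => ((hm n m).const_mul _).aemeasurable]
        simp only [lintegral_const_mul _ (hm n _)]

end GroupSeqModel

end

/-! ### Backward induction and its limit. -/

noncomputable section

namespace GroupSeqModel

variable {X : Type*} [MeasurableSpace X] (M : GroupSeqModel X) (l0 l1 : ℝ≥0)

theorem measurable_g : Measurable (g l0 l1) := by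
  unfold g
  fun_prop

theorem g_le (z : ℝ≥0∞) : g l0 l1 z ≤ l0 := min_le_left _ _

theorem tsum_p (k : ℕ) : ∑' m : M.G, M.p k m = 1 := (M.p k).tsum_coe

theorem measurable_groupMean (k : ℕ) {F : ℝ≥0∞ → ℝ≥0∞} (hF : Measurable F) :
    Measurable (M.groupMean k F) := by
  refine Measurable.tsum fun m => Measurable.const_mul ?_ _
  refine Measurable.lintegral_prod_right' (f := fun q : ℝ≥0∞ × M.Data (fun _ : Fin 1 => m) =>
    F (q.1 * M.z (fun _ : Fin 1 => m) q.2)) ?_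
  exact hF.comp (measurable_fst.mul ((M.measurable_z _).comp measurable_snd))

theorem groupMean_mono (k : ℕ) {F F' : ℝ≥0∞ → ℝ≥0∞} (h : ∀ z, F z ≤ F' z) (z : ℝ≥0∞) :
    M.groupMean k F z ≤ M.groupMean k F' z :=
  ENNReal.tsum_le_tsum fun _ => mul_le_mul_right (lintegral_mono fun _ => h _) _

theorem groupMean_le (k : ℕ) {F : ℝ≥0∞ → ℝ≥0∞} {a : ℝ≥0∞} (h : ∀ z, F z ≤ a) (z : ℝ≥0∞) :
    M.groupMean k F z ≤ a := by
  refine (M.groupMean_mono k h z).trans ?_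
  simp [groupMean, ENNReal.tsum_mul_right, M.tsum_p]

/-- Dominated convergence twice: over the sizes, as an integral for the counting measure with bound
`p_k(m) a`, and over the data with the constant bound `a`. -/
theorem tendsto_groupMean (k : ℕ) {F : ℕ → ℝ≥0∞ → ℝ≥0∞} {F' : ℝ≥0∞ → ℝ≥0∞}
    (hF : ∀ N, Measurable (F N)) (a : ℝ≥0) (ha : ∀ N z, F N z ≤ a)
    (h : ∀ z, Tendsto (fun N => F N z) atTop (𝓝 (F' z))) (z : ℝ≥0∞) :
    Tendsto (fun N => M.groupMean k (F N) z) atTop (𝓝 (M.groupMean k F' z)) := by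
  simp only [groupMean, ← lintegral_count]
  refine tendsto_lintegral_of_dominated_convergence (fun m => M.p k m * a)
    (fun _ => Measurable.of_discrete) (fun N => ae_of_all _ fun m => ?_) ?_ (ae_of_all _ fun m => ?_)
  · refine mul_le_mul_right ((lintegral_mono fun _ => ha _ _).trans ?_) _
    simp
  · simp [lintegral_count, ENNReal.tsum_mul_right, M.tsum_p]
  · refine ENNReal.Tendsto.const_mul ?_ (.inr ((M.p k).apply_ne_top m))
    refine tendsto_lintegral_of_dominated_convergence (fun _ => a)
      (fun N => (hF N).comp ((M.measurable_z _).const_mul z))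
      (fun N => ae_of_all _ fun _ => ha _ _) (by simp) (ae_of_all _ fun _ => h _)

theorem VSteps_succ (d k : ℕ) (z : ℝ≥0∞) : M.VSteps l0 l1 (d + 1) k z =
    min (g l0 l1 z) (M.avgCost (k + 1) + M.groupMean (k + 1) (M.VSteps l0 l1 d (k + 1)) z) := rfl

theorem VSteps_le_g (d k : ℕ) (z : ℝ≥0∞) : M.VSteps l0 l1 d k z ≤ g l0 l1 z := by
  cases d with
  | zero => exact le_rfl
  | succ d => exact min_le_left _ _

theorem measurable_VSteps (d k : ℕ) : Measurable (M.VSteps l0 l1 d k) := by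
  induction d generalizing k with
  | zero => exact measurable_g l0 l1
  | succ d ih =>
    exact (measurable_g l0 l1).min (measurable_const.add (M.measurable_groupMean _ (ih _)))

/-- A longer horizon can only lower the value: the first step is `min (g, …) ≤ g`, and monotone
averaging propagates the inequality. -/
theorem VSteps_succ_le (d k : ℕ) (z : ℝ≥0∞) :
    M.VSteps l0 l1 (d + 1) k z ≤ M.VSteps l0 l1 d k z := by
  induction d generalizing k z with
  | zero => exact min_le_left _ _
  | succ d ih =>
    rw [VSteps_succ, VSteps_succ]
    gcongr
    exact M.groupMean_mono _ (ih _) _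

theorem tendsto_VN (k : ℕ) (z : ℝ≥0∞) :
    Tendsto (fun N => M.VN l0 l1 N k z) atTop (𝓝 (M.V l0 l1 k z)) := by
  have h : Antitone fun d => M.VSteps l0 l1 d k z :=
    antitone_nat_of_succ_le fun d => M.VSteps_succ_le l0 l1 d k z
  -- Truncation of `N - k` for `N < k` affects only finitely many terms.
  exact tendsto_nhds_limUnder ⟨_, (tendsto_atTop_iInf h).comp (tendsto_sub_atTop_nat k)⟩

theorem V_le_g (k : ℕ) (z : ℝ≥0∞) : M.V l0 l1 k z ≤ g l0 l1 z :=
  le_of_tendsto' (M.tendsto_VN l0 l1 k z) fun _ => M.VSteps_le_g l0 l1 _ _ _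

theorem measurable_V (k : ℕ) : Measurable (M.V l0 l1 k) :=
  measurable_of_tendsto_metrizable (fun N => M.measurable_VSteps l0 l1 (N - k) k)
    (tendsto_pi_nhds.2 (M.tendsto_VN l0 l1 k))

theorem tendsto_VNbar (k : ℕ) (z : ℝ≥0∞) :
    Tendsto (fun N => M.VNbar l0 l1 N k z) atTop (𝓝 (M.Vbar l0 l1 k z)) :=
  M.tendsto_groupMean k (fun N => M.measurable_VSteps l0 l1 (N - k) k) l0
    (fun _ _ => (M.VSteps_le_g l0 l1 _ _ _).trans (g_le _ _ _)) (M.tendsto_VN l0 l1 k) z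

theorem measurable_Vbar (k : ℕ) : Measurable (M.Vbar l0 l1 k) :=
  M.measurable_groupMean k (M.measurable_V l0 l1 k)

theorem Vbar_le (k : ℕ) (z : ℝ≥0∞) : M.Vbar l0 l1 k z ≤ l0 :=
  M.groupMean_le k (fun _ => (M.V_le_g l0 l1 _ _).trans (g_le _ _ _)) z

/-- The optimality equation of the infinite-horizon problem. -/
theorem V_eq (k : ℕ) (z : ℝ≥0∞) :
    M.V l0 l1 k z = min (g l0 l1 z) (M.avgCost (k + 1) + M.Vbar l0 l1 (k + 1) z) := by
  have h1 : Tendsto (fun N => min (g l0 l1 z) (M.avgCost (k + 1) + M.VNbar l0 l1 N (k + 1) z)) atTop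
      (𝓝 (min (g l0 l1 z) (M.avgCost (k + 1) + M.Vbar l0 l1 (k + 1) z))) :=
    tendsto_const_nhds.min (tendsto_const_nhds.add (M.tendsto_VNbar l0 l1 (k + 1) z))
  refine tendsto_nhds_unique (M.tendsto_VN l0 l1 k z) (h1.congr' ?_)
  -- The recursion for `V_k^N` needs `N ≥ k + 1`, since `V_k^k = g`.
  filter_upwards [eventually_ge_atTop (k + 1)] with N hN
  obtain ⟨d, rfl⟩ := Nat.exists_eq_add_of_le hN
  simp only [VN, VNbar, show k + 1 + d - k = d + 1 by omega, VSteps_succ]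
  congr 3
  funext w
  simp [VN]

/-! ### Expectations over one more group. -/

variable {M}

theorem mean_eq_zero_iff {k : ℕ} {h : ∀ n : Fin k → M.G, M.Data n → ℝ≥0∞}
    (hh : ∀ n, Measurable (h n)) :
    M.mean k h = 0 ↔ ∀ n, 0 < M.prob n → ∀ᵐ x ∂M.P 0 n, h n x = 0 := by
  simp only [mean, ENNReal.tsum_eq_zero, mul_eq_zero, lintegral_eq_zero_iff (hh _), pos_iff_ne_zero]
  exact forall_congr' fun n => or_iff_not_imp_left

/-- The expectation over `k + 1` groups of a function of the first `k` groups. -/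
theorem mean_succ_of_init {k : ℕ} {h : ∀ n : Fin k → M.G, M.Data n → ℝ≥0∞}
    (hh : ∀ n, Measurable (h n)) :
    M.mean (k + 1) (fun n x => h (fun l => n l.castSucc) (fun l => x l.castSucc)) = M.mean k h := by
  rw [mean_succ (fun n _ x _ => h n x) fun n m => (hh n).comp measurable_fst]
  refine mean_congr fun n x => ?_
  simp [ENNReal.tsum_mul_right, M.tsum_p]

/-- Expected cost plus expected value of a function of the likelihood ratio after one more group. -/
theorem mean_succ_cost {k : ℕ} {u : ∀ n : Fin k → M.G, M.Data n → ℝ≥0∞}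
    (hu : ∀ n, Measurable (u n)) {F : ℝ≥0∞ → ℝ≥0∞} (hF : Measurable F) :
    M.mean (k + 1) (fun n x => u (fun l => n l.castSucc) (fun l => x l.castSucc) *
        (M.totalCost n + F (M.z n x))) =
      M.mean k (fun n x => u n x *
        (M.totalCost n + (M.avgCost (k + 1) + M.groupMean (k + 1) F (M.z n x)))) := by
  have hFz : ∀ {n : Fin k → M.G} {m : M.G} (x : M.Data n),
      Measurable fun y => F (M.z n x * M.z (fun _ : Fin 1 => m) y) :=
    fun x => hF.comp ((M.measurable_z _).const_mul _)
  have h0 := mean_succ (fun n m x y => u n x * (M.totalCost n + M.cost m +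
    F (M.z n x * M.z (fun _ : Fin 1 => m) y))) fun n m =>
    ((hu n).comp measurable_fst).mul (measurable_const.add
      (hF.comp (((M.measurable_z _).comp measurable_fst).mul ((M.measurable_z _).comp measurable_snd))))
  refine (mean_congr fun n x => ?_).trans (h0.trans ?_)
  · rw [M.z_succ n x, totalCost_succ]
  · refine mean_congr fun n x => ?_
    have h : ∀ m, ∫⁻ y, u n x * (M.totalCost n + M.cost m +
        F (M.z n x * M.z (fun _ : Fin 1 => m) y)) ∂M.P 0 (fun _ : Fin 1 => m) =
        u n x * (M.totalCost n + (M.cost m +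
          ∫⁻ y, F (M.z n x * M.z (fun _ : Fin 1 => m) y) ∂M.P 0 (fun _ : Fin 1 => m))) := fun m => by
      rw [lintegral_const_mul _ ((hFz x).const_add _), lintegral_add_left measurable_const]
      simp [add_assoc]
    simp only [h, mul_left_comm _ (u n x), ENNReal.tsum_mul_left]
    congr 1
    simp only [mul_add, ENNReal.tsum_add, ENNReal.tsum_mul_right, M.tsum_p, one_mul, avgCost,
      groupMean]

end GroupSeqModel

end

noncomputable section

namespace GroupSeqModel

variable {X : Type*} [MeasurableSpace X] (M : GroupSeqModel X) (l0 l1 : ℝ≥0)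

/-! ### Optimal decision rules -/

/-- Where `f₀ = 0` both sides vanish, so the value of `z` there is irrelevant. -/
theorem density_mul_g {k : ℕ} (n : Fin k → M.G) (x : M.Data n) :
    M.density 0 n x * g l0 l1 (M.z n x) = min (l0 * M.density 0 n x) (l1 * M.density 1 n x) := by
  by_cases h : M.density 0 n x = 0
  · simp [h]
  · rw [g, mul_min, mul_comm _ (l0 : ℝ≥0∞), mul_left_comm, z,
      ENNReal.mul_div_cancel h (M.density_ne_top 0 n x)]

/-- The likelihood ratio test: reject `H₀` when `λ₀ f₀ ≤ λ₁ f₁`. -/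
def ratioTest : M.DecisionRule where
  val n := {x | l0 * M.density 0 n x ≤ l1 * M.density 1 n x}.indicator 1
  measurable_val n := measurable_one.indicator
    (measurableSet_le ((M.measurable_density 0 n).const_mul _) ((M.measurable_density 1 n).const_mul _))
  val_le_one _ := Set.indicator_le_self' fun _ _ => zero_le

/-- Putting all terms under the common measure `μ^n` allows `φ` to be optimized point by point. -/
theorem lagrangian_eq_tsum (ψ : M.StoppingRule) (φ : M.DecisionRule) :
    M.lagrangian l0 l1 ψ φ = ∑' k : ℕ, ∑' n : Fin (k + 1) → M.G, M.prob n *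
      ∫⁻ x, ψ.s n x * (M.density 0 n x * M.totalCost n +
        (l0 * M.density 0 n x * φ.val n x + l1 * M.density 1 n x * (1 - φ.val n x)))
          ∂M.muProd n := by
  simp only [lagrangian, K, errorI, errorII, ← ENNReal.tsum_mul_left, ← ENNReal.tsum_add]
  refine tsum_congr fun k => tsum_congr fun n => ?_
  have hs := M.measurable_s ψ n
  have h0 := M.measurable_density 0 n
  have h1 := M.measurable_density 1 n
  have hφ := φ.measurable_val n
  have ha : Measurable fun x => ψ.s n x * φ.val n x := hs.mul hφ
  have hb : Measurable fun x => ψ.s n x * (1 - φ.val n x) := hs.mul (hφ.const_sub 1)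
  have hs' : Measurable fun x => M.density 0 n x * ψ.s n x := h0.mul hs
  have ha' : Measurable fun x => M.density 0 n x * (ψ.s n x * φ.val n x) := h0.mul ha
  have hb' : Measurable fun x => M.density 1 n x * (ψ.s n x * (1 - φ.val n x)) := h1.mul hb
  rw [M.lintegral_P 0 n hs, M.lintegral_P 0 n ha, M.lintegral_P 1 n hb, mul_assoc, mul_left_comm (l0 : ℝ≥0∞),
    mul_left_comm (l1 : ℝ≥0∞), ← mul_add, ← mul_add,
    ← lintegral_const_mul _ hs', ← lintegral_const_mul _ ha',
    ← lintegral_const_mul _ hb',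
    ← lintegral_add_left (by fun_prop), ← lintegral_add_left (by fun_prop)]
  congr 1
  exact lintegral_congr fun x => by ring

theorem tsum_mean_stop_eq (ψ : M.StoppingRule) :
    ∑' k : ℕ, M.mean (k + 1) (fun n x => ψ.s n x * (M.totalCost n + g l0 l1 (M.z n x))) =
      ∑' k : ℕ, ∑' n : Fin (k + 1) → M.G, M.prob n *
        ∫⁻ x, ψ.s n x * (M.density 0 n x * M.totalCost n +
          min (l0 * M.density 0 n x) (l1 * M.density 1 n x)) ∂M.muProd n := by
  refine tsum_congr fun k => tsum_congr fun n => ?_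
  have h : Measurable fun x => ψ.s n x * (M.totalCost n + g l0 l1 (M.z n x)) :=
    (M.measurable_s ψ n).mul (((measurable_g l0 l1).comp (M.measurable_z n)).const_add _)
  dsimp only
  rw [M.lintegral_P 0 n h]
  congr 1
  refine lintegral_congr fun x => ?_
  rw [← density_mul_g]
  ring

theorem L_eq_tsum (ψ : M.StoppingRule) : M.L l0 l1 ψ =
    ∑' k : ℕ, M.mean (k + 1) (fun n x => ψ.s n x * (M.totalCost n + g l0 l1 (M.z n x))) := by
  rw [tsum_mean_stop_eq]
  refine le_antisymm ((iInf_le _ (M.ratioTest l0 l1)).trans_eq ?_) (le_iInf fun φ => ?_)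
  · rw [lagrangian_eq_tsum]
    refine tsum_congr fun k => tsum_congr fun n => ?_
    congr 1
    refine lintegral_congr fun x => ?_
    congr 2
    by_cases h : l0 * M.density 0 n x ≤ l1 * M.density 1 n x
    · simp [ratioTest, h]
    · simp [ratioTest, h, le_of_not_ge h]
  · rw [lagrangian_eq_tsum]
    refine ENNReal.tsum_le_tsum fun k => ENNReal.tsum_le_tsum fun n =>
      mul_le_mul_right (lintegral_mono fun x => ?_) _
    gcongr
    calc _ = min (l0 * M.density 0 n x) (l1 * M.density 1 n x) *
          (φ.val n x + (1 - φ.val n x)) := by rw [add_tsub_cancel_of_le (φ.val_le_one n x), mul_one]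
      _ ≤ _ := by
        rw [mul_add]
        gcongr
        · exact min_le_left _ _
        · exact min_le_right _ _

/-! ### Exact excess of the Lagrangian over the lower bound -/

theorem s_add (ψ : M.StoppingRule) {k : ℕ} (n : Fin k → M.G) (x : M.Data n) :
    ψ.s n x + ψ.t n x * (1 - ψ.val n x) = ψ.t n x := by
  rw [Rule.s, ← mul_add, add_tsub_cancel_of_le (ψ.val_le_one n x), mul_one]

theorem measurable_continue (ψ : M.StoppingRule) {k : ℕ} (n : Fin k → M.G) :
    Measurable fun x => ψ.t n x * (1 - ψ.val n x) :=
  (M.measurable_t ψ n).mul ((ψ.measurable_val n).const_sub 1)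

/-- The loss caused at a given point by the deviation of the rule from the optimal one. -/
def loss (ψ : M.StoppingRule) {k : ℕ} (n : Fin k → M.G) (x : M.Data n) : ℝ≥0∞ :=
  ψ.t n x * (ψ.val n x * (g l0 l1 (M.z n x) - M.V l0 l1 k (M.z n x)) +
    (1 - ψ.val n x) *
      (M.avgCost (k + 1) + M.Vbar l0 l1 (k + 1) (M.z n x) - M.V l0 l1 k (M.z n x)))

theorem measurable_loss (ψ : M.StoppingRule) {k : ℕ} (n : Fin k → M.G) :
    Measurable (M.loss l0 l1 ψ n) := by
  have hz := M.measurable_z n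
  have h1 := (measurable_g l0 l1).comp hz
  have h2 := (M.measurable_V l0 l1 k).comp hz
  have h3 := (M.measurable_Vbar l0 l1 (k + 1)).comp hz
  have h4 := ψ.measurable_val n
  exact (M.measurable_t ψ n).mul ((h4.mul (h1.sub h2)).add
    ((h4.const_sub 1).mul ((h3.const_add _).sub h2)))

/-- Since `v` lies below both `a` and `b`, the truncated differences are exact; no finiteness is
needed. -/
theorem mul_add_excess (t c : ℝ≥0∞) {p q v a b : ℝ≥0∞} (h : p + q = 1) (ha : v ≤ a) (hb : v ≤ b) :
    t * (c + v) + t * (p * (a - v) + q * (b - v)) = t * p * (c + a) + t * q * (c + b) := by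
  calc _ = t * ((p + q) * (c + v)) + t * (p * (a - v) + q * (b - v)) := by rw [h, one_mul]
    _ = t * p * (c + (v + (a - v))) + t * q * (c + (v + (b - v))) := by ring
    _ = _ := by rw [add_tsub_cancel_of_le ha, add_tsub_cancel_of_le hb]

/-- With `V = min (a, b)`, `loss` is the average excess of the chosen alternative over `V`; the
continuing part, averaged over the next group, becomes the last term. -/
theorem mean_value_step (ψ : M.StoppingRule) (k : ℕ) :
    M.mean (k + 1) (fun n x => ψ.t n x * (M.totalCost n + M.V l0 l1 (k + 1) (M.z n x))) +
        M.mean (k + 1) (fun n x => M.loss l0 l1 ψ n x) =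
      M.mean (k + 1) (fun n x => ψ.s n x * (M.totalCost n + g l0 l1 (M.z n x))) +
        M.mean (k + 2)
          (fun n x => ψ.t n x * (M.totalCost n + M.V l0 l1 (k + 2) (M.z n x))) := by
  have h := mean_succ_cost (fun n => M.measurable_continue ψ (k := k + 1) n)
    (M.measurable_V l0 l1 (k + 2))
  -- After `k + 2` groups, `t` depends on the first `k + 1` groups only, as `mean_succ_cost`
  -- requires.
  simp only [t_succ] at h ⊢
  rw [h, ← mean_add, ← mean_add]
  · refine mean_congr fun n x => ?_
    have h1 := M.V_eq l0 l1 (k + 1) (M.z n x)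
    have hg : M.V l0 l1 (k + 1) (M.z n x) ≤ g l0 l1 (M.z n x) := h1.trans_le (min_le_left _ _)
    have hb : M.V l0 l1 (k + 1) (M.z n x) ≤
        M.avgCost (k + 1 + 1) + M.Vbar l0 l1 (k + 1 + 1) (M.z n x) := h1.trans_le (min_le_right _ _)
    exact mul_add_excess _ _ (add_tsub_cancel_of_le (ψ.val_le_one n x)) hg hb
  · exact fun n => (M.measurable_s ψ n).mul
      (((measurable_g l0 l1).comp (M.measurable_z n)).const_add _)
  · exact fun n => (M.measurable_t ψ n).mul
      (((M.measurable_V l0 l1 _).comp (M.measurable_z n)).const_add _)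

/-- The first group is always taken, so `t = 1`, and the likelihood ratio starts from `1`. -/
theorem mean_value_one (ψ : M.StoppingRule) :
    M.mean 1 (fun n x => ψ.t n x * (M.totalCost n + M.V l0 l1 1 (M.z n x))) =
      M.avgCost 1 + M.Vbar l0 l1 1 1 := by
  rw [mean_one, avgCost, Vbar, groupMean, ← ENNReal.tsum_add]
  refine tsum_congr fun m => ?_
  simp only [t_one, one_mul]
  rw [lintegral_add_left measurable_const, ← mul_add]
  simp [totalCost]

theorem value_add_loss (ψ : M.StoppingRule) (N : ℕ) :
    M.avgCost 1 + M.Vbar l0 l1 1 1 +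
        ∑ k ∈ Finset.range N, M.mean (k + 1) (fun n x => M.loss l0 l1 ψ n x) =
      ∑ k ∈ Finset.range N,
          M.mean (k + 1) (fun n x => ψ.s n x * (M.totalCost n + g l0 l1 (M.z n x))) +
        M.mean (N + 1)
          (fun n x => ψ.t n x * (M.totalCost n + M.V l0 l1 (N + 1) (M.z n x))) := by
  induction N with
  | zero => simp [mean_value_one]
  | succ N ih =>
    rw [Finset.sum_range_succ, ← add_assoc, ih, add_assoc, mean_value_step, ← add_assoc,
      Finset.sum_range_succ]

/-! ### The remainder for terminating rules -/

/-- The surviving mass either stops now or goes on; a weight depending on the sizes so far is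
unaffected by averaging over the next group. -/
theorem mean_continue_step (ψ : M.StoppingRule) {k : ℕ} (w : (Fin (k + 1) → M.G) → ℝ≥0∞) :
    M.mean (k + 1) (fun n x => ψ.t n x * w n) = M.mean (k + 1) (fun n x => ψ.s n x * w n) +
      M.mean (k + 2) (fun n x => ψ.t n x * w (fun l => n l.castSucc)) := by
  simp only [t_succ]
  have h := mean_succ_of_init (M := M) (h := fun n x => ψ.t n x * (1 - ψ.val n x) * w n)
    fun n => (M.measurable_continue ψ (k := k + 1) n).mul_const (w n)
  rw [h, ← mean_add fun n => (M.measurable_s ψ n).mul_const _]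
  exact mean_congr fun n x => by rw [← add_mul, s_add]

variable {M}

/-- The probabilities of having stopped and of still running add up to `1` at every stage. -/
theorem tendsto_mean_t {ψ : M.StoppingRule} (hψ : ψ ∈ M.terminating 0) :
    Tendsto (fun N => M.mean (N + 1) (fun n x => ψ.t n x)) atTop (𝓝 0) := by
  have hsum : ∑' k : ℕ, M.mean (k + 1) (fun n x => ψ.s n x) = 1 := hψ
  have h : ∀ N, ∑ k ∈ Finset.range N, M.mean (k + 1) (fun n x => ψ.s n x) +
      M.mean (N + 1) (fun n x => ψ.t n x) = 1 := fun N => by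
    induction N with
    | zero => simp [mean_one, t_one, M.tsum_p]
    | succ N ih =>
      have h1 := M.mean_continue_step ψ (k := N) fun _ => 1
      simp only [mul_one] at h1
      rw [Finset.sum_range_succ, add_assoc, ← h1, ih]
  have hle : ∀ N, ∑ k ∈ Finset.range N, M.mean (k + 1) (fun n x => ψ.s n x) ≠ ∞ := fun N =>
    ne_top_of_le_ne_top ENNReal.one_ne_top (le_self_add.trans_eq (h N))
  have h2 := ENNReal.tendsto_nat_tsum fun k => M.mean (k + 1) (fun n x => ψ.s n x)
  rw [hsum] at h2
  have h3 := ENNReal.Tendsto.sub (tendsto_const_nhds (x := (1 : ℝ≥0∞))) h2 (.inl ENNReal.one_ne_top)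
  rw [tsub_self] at h3
  refine h3.congr fun N => ?_
  rw [← h N, ENNReal.add_sub_cancel_left (hle N)]

theorem totalCost_ne_top {k : ℕ} (n : Fin k → M.G) : M.totalCost n ≠ ∞ :=
  ENNReal.sum_ne_top.2 fun _ _ => ENNReal.coe_ne_top

/-- The cost accumulated so far, on the event of continuation, is at most the cost still to be
paid. -/
theorem mean_t_cost_le {ψ : M.StoppingRule} (hψ : ψ ∈ M.terminating 0) (k : ℕ) :
    M.mean (k + 1) (fun n x => ψ.t n x * M.totalCost n) ≤
      ∑' i : ℕ, M.mean (k + i + 1) (fun n x => ψ.s n x * M.totalCost n) := by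
  -- Truncating the cost at `K` bounds the remainder by `K` times the surviving mass, which tends to
  -- `0`; the untruncated cost may be unbounded over the sizes.
  have hK : ∀ K : ℝ≥0∞, K ≠ ∞ → M.mean (k + 1) (fun n x => ψ.t n x * min (M.totalCost n) K) ≤
      ∑' i : ℕ, M.mean (k + i + 1) (fun n x => ψ.s n x * M.totalCost n) := fun K hK => by
    have hN : ∀ N : ℕ, M.mean (k + 1) (fun n x => ψ.t n x * min (M.totalCost n) K) ≤
        ∑ i ∈ Finset.range N, M.mean (k + i + 1) (fun n x => ψ.s n x * M.totalCost n) +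
          M.mean (k + N + 1) (fun n x => ψ.t n x * min (M.totalCost n) K) := fun N => by
      induction N with
      | zero => simp
      | succ N ih =>
        refine ih.trans ?_
        rw [Finset.sum_range_succ]
        refine (add_le_add le_rfl ?_).trans_eq (add_assoc _ _ _).symm
        rw [mean_continue_step]
        refine add_le_add (mean_mono fun n x => ?_) (mean_mono fun n x => ?_)
        · exact mul_le_mul_right (min_le_left _ _) _
        · have h : M.totalCost (fun l : Fin (k + N + 1) => n l.castSucc) ≤ M.totalCost n := by
            rw [M.totalCost_succ n]
            exact le_self_add
          exact mul_le_mul_right (min_le_min_right _ h) _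
    have h0 : Tendsto (fun N => K * M.mean (k + N + 1) (fun n x => ψ.t n x)) atTop (𝓝 0) := by
      have h := ENNReal.Tendsto.const_mul (a := K)
        ((tendsto_mean_t hψ).comp (tendsto_atTop_mono (Nat.le_add_left · k) tendsto_id)) (.inr hK)
      rw [mul_zero] at h
      exact h
    have h1 := h0.const_add (∑' i : ℕ, M.mean (k + i + 1) (fun n x => ψ.s n x * M.totalCost n))
    rw [add_zero] at h1
    refine ge_of_tendsto' h1 fun N => ?_
    refine (hN N).trans (add_le_add (ENNReal.sum_le_tsum _) ?_)
    rw [← mean_const_mul fun n => M.measurable_t ψ n]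
    exact mean_mono fun n x => (mul_le_mul_right (min_le_right _ _) _).trans_eq (mul_comm _ _)
  -- The truncation is removed on finitely many size vectors at a time: `K`, the sum of their costs,
  -- exceeds each of them.
  rw [mean, ENNReal.tsum_eq_iSup_sum]
  refine iSup_le fun F => ?_
  refine le_trans ?_ (hK (∑ n ∈ F, M.totalCost n)
    (ENNReal.sum_ne_top.2 fun n _ => totalCost_ne_top n))
  refine le_trans (Finset.sum_le_sum fun n hn => ?_) (ENNReal.sum_le_tsum F)
  dsimp only
  rw [min_eq_left (Finset.single_le_sum (f := M.totalCost) (fun _ _ => zero_le) hn)]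

theorem tendsto_mean_value {ψ : M.StoppingRule} (hψ : ψ ∈ M.terminating 0)
    (hL : M.L l0 l1 ψ ≠ ∞) :
    Tendsto (fun N => M.mean (N + 1)
      (fun n x => ψ.t n x * (M.totalCost n + M.V l0 l1 (N + 1) (M.z n x)))) atTop (𝓝 0) := by
  have hC : ∑' k : ℕ, M.mean (k + 1) (fun n x => ψ.s n x * M.totalCost n) ≠ ∞ := by
    rw [L_eq_tsum] at hL
    exact ne_top_of_le_ne_top hL (ENNReal.tsum_le_tsum fun k => mean_mono fun n x =>
      mul_le_mul_right le_self_add _)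
  have h1 := ENNReal.tendsto_sum_nat_add _ hC
  have h2 := ENNReal.Tendsto.const_mul (a := (l0 : ℝ≥0∞)) (tendsto_mean_t hψ)
    (.inr ENNReal.coe_ne_top)
  have h3 := h1.add h2
  rw [mul_zero, add_zero] at h3
  refine tendsto_of_tendsto_of_tendsto_of_le_of_le tendsto_const_nhds h3 (fun _ => zero_le)
    fun N => ?_
  calc _ ≤ M.mean (N + 1) (fun n x => ψ.t n x * M.totalCost n + l0 * ψ.t n x) := by
        refine mean_mono fun n x => ?_
        rw [mul_add, mul_comm (l0 : ℝ≥0∞)]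
        gcongr
        exact (M.V_le_g _ _ _ _).trans (g_le _ _ _)
    _ = _ := by
        rw [mean_add fun n => (M.measurable_t ψ n).mul_const _,
          mean_const_mul fun n => M.measurable_t ψ n]
    _ ≤ _ := by
        refine add_le_add ((mean_t_cost_le hψ N).trans_eq ?_) le_rfl
        exact tsum_congr fun i => congrArg
          (fun j => M.mean (j + 1) (fun n x => ψ.s n x * M.totalCost n)) (add_comm N i)

/-- The remainder is simply dropped, so neither termination nor finiteness of `L` is needed; this is
what yields finiteness when the loss is zero. -/
theorem L_le_value_add_loss (ψ : M.StoppingRule) : M.L l0 l1 ψ ≤ M.avgCost 1 + M.Vbar l0 l1 1 1 +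
    ∑' k : ℕ, M.mean (k + 1) (fun n x => M.loss l0 l1 ψ n x) := by
  rw [L_eq_tsum]
  refine ENNReal.tsum_le_of_sum_range_le fun N => ?_
  refine le_self_add.trans ((M.value_add_loss l0 l1 ψ N).symm.trans_le ?_)
  exact add_le_add le_rfl (ENNReal.sum_le_tsum _)

theorem L_eq_value_add_loss {ψ : M.StoppingRule} (hψ : ψ ∈ M.terminating 0)
    (hL : M.L l0 l1 ψ ≠ ∞) : M.L l0 l1 ψ = M.avgCost 1 + M.Vbar l0 l1 1 1 +
      ∑' k : ℕ, M.mean (k + 1) (fun n x => M.loss l0 l1 ψ n x) := by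
  have h1 := (ENNReal.tendsto_nat_tsum fun k => M.mean (k + 1)
    (fun n x => ψ.s n x * (M.totalCost n + g l0 l1 (M.z n x)))).add
    (tendsto_mean_value l0 l1 hψ hL)
  have h2 := (ENNReal.tendsto_nat_tsum fun k => M.mean (k + 1)
    (fun n x => M.loss l0 l1 ψ n x)).const_add (M.avgCost 1 + M.Vbar l0 l1 1 1)
  simp only [value_add_loss] at h2
  rw [← L_eq_tsum, add_zero] at h1
  exact tendsto_nhds_unique h1 h2

theorem loss_eq_zero_iff (ψ : M.StoppingRule) {k : ℕ} (n : Fin k → M.G) (x : M.Data n) :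
    M.loss l0 l1 ψ n x = 0 ↔ (0 < ψ.t n x → SimInd (ψ.val n x) (g l0 l1 (M.z n x))
      (M.avgCost (k + 1) + M.Vbar l0 l1 (k + 1) (M.z n x))) := by
  rw [loss, V_eq, mul_eq_zero, or_iff_not_imp_left, pos_iff_ne_zero]
  refine imp_congr_right fun _ => ?_
  have hψ := ψ.val_le_one n x
  generalize ψ.val n x = p at *
  generalize g l0 l1 (M.z n x) = a
  generalize M.avgCost (k + 1) + M.Vbar l0 l1 (k + 1) (M.z n x) = b
  -- Zero loss forces `p = 1` if `a < b`, nothing if `a = b`, and `p = 0` if `b < a`.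
  rcases lt_trichotomy a b with h | rfl | h
  · have : b - a ≠ 0 := (tsub_pos_of_lt h).ne'
    simp [SimInd, h, h.le, hψ, this, tsub_eq_zero_iff_le]
  · simp [SimInd, hψ]
  · have : a - b ≠ 0 := (tsub_pos_of_lt h).ne'
    simp [SimInd, h.le, h.not_ge, h.not_gt, this]

theorem tsum_loss_eq_zero_iff (ψ : M.StoppingRule) :
    ∑' k : ℕ, M.mean (k + 1) (fun n x => M.loss l0 l1 ψ n x) = 0 ↔ M.CondS l0 l1 ψ := by
  rw [ENNReal.tsum_eq_zero]
  simp only [mean_eq_zero_iff fun n => M.measurable_loss l0 l1 ψ n, loss_eq_zero_iff]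
  constructor
  · intro h k hk
    obtain ⟨k, rfl⟩ := Nat.exists_eq_add_of_le' hk
    exact h k
  · exact fun h k => h (k + 1) (Nat.le_add_left 1 k)

end GroupSeqModel

end

/-! ### The main theorem. -/

theorem mainTheorem2 {X : Type*} [MeasurableSpace X] (M : GroupSeqModel X)
    (l0 l1 : ℝ≥0) (hl0 : 0 < l0) (hl1 : 0 < l1) :
    (∀ k : ℕ, 1 ≤ k → ∀ z : ℝ≥0∞, z < ∞ →
      Tendsto (fun N => M.VN l0 l1 N k z) atTop (𝓝 (M.V l0 l1 k z)) ∧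
      Tendsto (fun N => M.VNbar l0 l1 N k z) atTop (𝓝 (M.Vbar l0 l1 k z))) ∧
    ∀ ψ ∈ M.terminating 0,
      M.L l0 l1 ψ = ∑' k : ℕ, ∑' n : Fin (k + 1) → M.G, M.prob n *
        ∫⁻ x, ψ.s n x * (M.totalCost n + GroupSeqModel.g l0 l1 (M.z n x)) ∂M.P 0 n ∧
      M.avgCost 1 + M.Vbar l0 l1 1 1 ≤ M.L l0 l1 ψ ∧
      (M.L l0 l1 ψ = M.avgCost 1 + M.Vbar l0 l1 1 1 ↔ M.CondS l0 l1 ψ) := by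
  refine ⟨fun k _ z _ => ⟨M.tendsto_VN l0 l1 k z, M.tendsto_VNbar l0 l1 k z⟩,
    fun ψ hψ => ⟨M.L_eq_tsum l0 l1 ψ, ?_, ?_⟩⟩
  · by_cases hL : M.L l0 l1 ψ = ∞
    · simp [hL]
    · rw [GroupSeqModel.L_eq_value_add_loss l0 l1 hψ hL]
      exact le_self_add
  -- Finiteness of the bound lets it be cancelled, and makes `L` finite in both directions of the
  -- equivalence.
  · have hfin : M.avgCost 1 + M.Vbar l0 l1 1 1 ≠ ∞ :=
      ENNReal.add_ne_top.2 ⟨(M.avgCost_lt_top 1 le_rfl).ne,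
        ne_top_of_le_ne_top ENNReal.coe_ne_top (M.Vbar_le l0 l1 1 1)⟩
    rw [← GroupSeqModel.tsum_loss_eq_zero_iff]
    constructor
    · intro h
      have h1 := GroupSeqModel.L_eq_value_add_loss l0 l1 hψ (h ▸ hfin)
      rw [h] at h1
      exact (ENNReal.add_right_inj hfin).1 (h1.symm.trans (add_zero _).symm)
    · intro h
      have h1 := GroupSeqModel.L_le_value_add_loss l0 l1 ψ
      rw [h, add_zero] at h1
      rw [GroupSeqModel.L_eq_value_add_loss l0 l1 hψ (ne_top_of_le_ne_top hfin h1), h, add_zero]
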